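/- Let $K\ge 1$ and let $N_0,N_1,\dots,N_K$ be positive integers with $N_0=\min_{0\le k\le K}N_k$. Let $Q_1,\dots,Q_K$ be random matrices, $Q_k$ of size $N_k\times N_{k-1}$, such that all entries of all these matrices are independent circularly symmetric complex Gaussian variables with zero mean and unit variance (density $\pi^{-1}e^{-|z|^2}$ on $\mathbb{C}$). Put $H=Q_KQ_{K-1}\cdots Q_1$, and for $q>0$ let $$\tilde R(q)=\mathbb{E}\bigl[\ln\det(I+qH^\dagger H)\bigr]$$ be the ergodic capacity of the Rayleigh product channel with signal-to-noise ratio $q$. Let $\gamma$ be the Euler–Mascheroni constant and $$g=\frac1{N_0}\sum_{k=1}^{K}\sum_{\ell=1}^{N_0}\sum_{r=1}^{N_k-\ell}\frac1r .$$ Then $\tilde R(q)$ is finite, and the lower bound $$N_0\ln\bigl(1+q\,e^{g-K\gamma}\bigr)\le\tilde R(q)\qquad(q>0)$$ holds and is asymptotically tight as $q\to\infty$: $$\lim_{q\to\infty}\Bigl(\tilde R(q)-N_0\ln\bigl(1+q\,e^{g-K\gamma}\bigr)\Bigr)=0 .$$ Moreover $\det(H^\dagger H)>0$ almost surely, $\ln\det(H^\dagger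 H)$ is integrable, and $$\lim_{q\to\infty}\bigl(\tilde R(q)-N_0\ln q\bigr)=\mathbb{E}\bigl[\ln\det(H^\dagger H)\bigr]=N_0(g-K\gamma).$$ -/

import Mathlib

open MeasureTheory ProbabilityTheory Filter Topology
open scoped Matrix

/-- The circularly symmetric complex Gaussian law with zero mean and unit variance: density
`exp (-|z|²) / π` with respect to Lebesgue measure on `ℂ`. -/
noncomputable def stdComplexGaussian : Measure ℂ :=
  volume.withDensity (fun z : ℂ => ENNReal.ofReal (Real.exp (-‖z‖ ^ 2) / Real.pi))

/-- `Q 0, …, Q (K - 1)` are the channel matrices `Q_1, …, Q_K` of the `K` tiers (so `Q k` is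
`Q_{k+1}`, of size `N_{k+1} × N_k`): all entries of all of these matrices are independent, with
the standard complex Gaussian law. The values `Q k` with `k ≥ K` play no role. -/
structure IsRayleighChain {Ω : Type*} [MeasurableSpace Ω] (P : Measure Ω) (K : ℕ) (N : ℕ → ℕ)
    (Q : (k : ℕ) → Ω → Matrix (Fin (N (k + 1))) (Fin (N k)) ℂ) : Prop where
  /-- each entry is standard complex Gaussian -/
  law : ∀ k < K, ∀ (i : Fin (N (k + 1))) (j : Fin (N k)),
    HasLaw (fun ω => Q k ω i j) stdComplexGaussian P
  /-- the entries are jointly independent -/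
  indep : iIndepFun
    (fun (e : Σ k : Fin K, Fin (N ((k : ℕ) + 1)) × Fin (N (k : ℕ))) (ω : Ω) =>
      Q (e.1 : ℕ) ω e.2.1 e.2.2) P

/-- The product channel `H = Q_K ⋯ Q_2 Q_1`, of size `N_K × N_0`. -/
noncomputable def productChannel {Ω : Type*} (N : ℕ → ℕ)
    (Q : (k : ℕ) → Ω → Matrix (Fin (N (k + 1))) (Fin (N k)) ℂ) :
    (K : ℕ) → Ω → Matrix (Fin (N K)) (Fin (N 0)) ℂ
  | 0, _ => 1
  | K + 1, ω => Q K ω * productChannel N Q K ω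

/-- `ln det A`, used for Hermitian `A`, whose determinant is real. -/
noncomputable def lnDet {n : ℕ} (A : Matrix (Fin n) (Fin n) ℂ) : ℝ :=
  Real.log A.det.re

/-- The capacity `ln det (I + q H† H)`, in nats per channel use. -/
noncomputable def capacity {m n : ℕ} (H : Matrix (Fin m) (Fin n) ℂ) (q : ℝ) : ℝ :=
  lnDet (1 + (q : ℂ) • (Hᴴ * H))

/-- The ergodic capacity `E [ln det (I + q H† H)]` of a random channel matrix `H`. -/
noncomputable def ergodicCapacity {Ω : Type*} [MeasurableSpace Ω] (P : Measure Ω) {m n : ℕ}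
    (H : Ω → Matrix (Fin m) (Fin n) ℂ) (q : ℝ) : ℝ :=
  ∫ ω, capacity (H ω) q ∂P

/-- `g = (1 / N_0) ∑_{k=1}^K ∑_{ℓ=1}^{N_0} ∑_{r=1}^{N_k - ℓ} 1 / r`, used when
`1 ≤ N_0 ≤ N_k` for all `k ≤ K`. -/
noncomputable def gConst (K : ℕ) (N : ℕ → ℕ) : ℝ :=
  (1 / (N 0 : ℝ)) * ∑ k ∈ Finset.Icc 1 K, ∑ l ∈ Finset.Icc 1 (N 0),
    ∑ r ∈ Finset.Icc 1 (N k - l), (1 / (r : ℝ))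

/-- The lower bound `N_0 ln (1 + q exp (g - K γ))` for the ergodic capacity. -/
noncomputable def capacityLowerBound (K : ℕ) (N : ℕ → ℕ) (q : ℝ) : ℝ :=
  (N 0 : ℝ) *
    Real.log (1 + q * Real.exp (gConst K N - (K : ℝ) * Real.eulerMascheroniConstant))

/-! Everything rests on the mean of `ln det (H† H)`. If `d i` are the squared singular values of
`H`, the capacity is `∑ log (1 + q * d i)`. Since `x ↦ log (1 + q * exp x)` is convex, its tangent
at `a`, evaluated at the `log (d i)` and summed, bounds the capacity below by an affine function of
`ln det (H† H)` (`tangent_le_capacity`). With `a = E[ln det (H† H)] / N 0` the linear correction has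
mean zero, which leaves the lower bound. Subtracting `N 0 * log q` turns the capacity into `∑ log
(1/q + d i)`, which tends to `ln det (H† H)` and is dominated uniformly in `q ≥ 1`
(`abs_capacity_sub_le`). The lower bound has the same limit, hence tightness.

The mean is computed tier by tier. Given the earlier tiers, write their product as `W * T` with `W`
an isometry. By unitary invariance the next Gaussian matrix times `W` is again Gaussian, now with `N
0` columns, so the Gram determinant factors in law and logarithmic means add
(`HasLogMean.gramDet_mul_gaussian`). For one Gaussian matrix, splitting off a column and projecting
the others onto its orthogonal complement (`gramDet_fromCols`, `hasLogMean_gramDet_gaussian`)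
produces independent Gamma factors, whose logarithmic means `harmonic n - γ` come from the
derivative of the Gamma function (`integral_gamma_log`). -/

/-! ### The standard complex Gaussian law. -/

/-- Integrals of radial functions against the standard complex Gaussian law: `‖z‖²` is
exponentially distributed. -/
lemma lintegral_stdComplexGaussian_norm_sq {f : ℝ → ENNReal} (hf : Measurable f) :
    ∫⁻ z, f (‖z‖ ^ 2) ∂stdComplexGaussian =
      ∫⁻ s in Set.Ioi (0 : ℝ), ENNReal.ofReal (Real.exp (-s)) * f s := by
  have himg : (fun r : ℝ => r ^ 2) '' Set.Ioi 0 = Set.Ioi 0 := by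
    ext y
    constructor
    · rintro ⟨x, hx, rfl⟩
      exact pow_pos (Set.mem_Ioi.1 hx) 2
    · intro hy
      exact ⟨√y, Real.sqrt_pos.2 hy, Real.sq_sqrt (le_of_lt hy)⟩
  have hcov := lintegral_image_eq_lintegral_abs_deriv_mul (s := Set.Ioi (0 : ℝ))
    (f := fun r : ℝ => r ^ 2) (f' := fun r => 2 * r) measurableSet_Ioi
    (fun x _ => by simpa using (hasDerivAt_pow 2 x).hasDerivWithinAt)
    (fun x hx y hy h => (pow_left_inj₀ (le_of_lt hx) (le_of_lt hy) two_ne_zero).1 h)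
    (fun s => ENNReal.ofReal (Real.exp (-s)) * f s)
  rw [himg] at hcov
  rw [hcov, stdComplexGaussian,
    lintegral_withDensity_eq_lintegral_mul _ (by fun_prop) (by fun_prop),
    ← Complex.lintegral_comp_polarCoord_symm, polarCoord_target]
  have h1 : ∀ p ∈ Set.Ioi (0 : ℝ) ×ˢ Set.Ioo (-Real.pi) Real.pi,
      ENNReal.ofReal p.1 • ((fun z : ℂ => ENNReal.ofReal (Real.exp (-‖z‖ ^ 2) / Real.pi)) *
        fun z : ℂ => f (‖z‖ ^ 2)) (Complex.polarCoord.symm p) =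
      (ENNReal.ofReal |2 * p.1| * (ENNReal.ofReal (Real.exp (-p.1 ^ 2)) * f (p.1 ^ 2))) *
        ENNReal.ofReal (1 / (2 * Real.pi)) := by
    rintro p ⟨hp, -⟩
    have hp : 0 < p.1 := hp
    simp only [Pi.mul_apply, Complex.norm_polarCoord_symm, sq_abs, smul_eq_mul]
    rw [← mul_assoc, ← mul_assoc, mul_right_comm _ (f _), ← ENNReal.ofReal_mul (by positivity),
      ← ENNReal.ofReal_mul (by positivity), ← ENNReal.ofReal_mul (by positivity),
      abs_of_pos (by positivity)]
    congr 2
    field_simp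
  rw [setLIntegral_congr_fun (measurableSet_Ioi.prod measurableSet_Ioo) h1,
    Measure.volume_eq_prod, ← Measure.prod_restrict,
    lintegral_prod_mul (f := fun r : ℝ => ENNReal.ofReal |2 * r| *
      (ENNReal.ofReal (Real.exp (-r ^ 2)) * f (r ^ 2)))
      (g := fun _ => ENNReal.ofReal (1 / (2 * Real.pi))) (by fun_prop) (by fun_prop),
    setLIntegral_const, Real.volume_Ioo,
    ← ENNReal.ofReal_mul (by positivity)]
  rw [show 1 / (2 * Real.pi) * (Real.pi - -Real.pi) = 1 by field_simp; ring]
  simp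

instance isProbabilityMeasure_stdComplexGaussian : IsProbabilityMeasure stdComplexGaussian := by
  constructor
  have h := lintegral_stdComplexGaussian_norm_sq (f := fun _ => 1) measurable_const
  simp only [lintegral_const, one_mul, mul_one] at h
  rw [h, ← ofReal_integral_eq_lintegral_ofReal (exp_neg_integrableOn_Ioi 0 one_pos |>.congr_fun
    (fun x _ => by simp) measurableSet_Ioi) (ae_of_all _ fun x => (Real.exp_pos _).le),
    integral_exp_neg_Ioi_zero, ENNReal.ofReal_one]

/-- This is the Fourier transform of a real Gaussian on the plane; the `1/4` reflects variance `1/2`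
in each real coordinate. -/
lemma charFunDual_stdComplexGaussian (L : StrongDual ℝ ℂ) (w : ℂ)
    (hL : ∀ z, L z = (star w * z).re) :
    charFunDual stdComplexGaussian L = Complex.exp (-(star w * w).re / 4) := by
  have h := GaussianFourier.integral_cexp_neg_mul_sq_norm_add (V := ℂ) (b := 1) (by simp)
    Complex.I w
  rw [charFunDual_apply, stdComplexGaussian,
    integral_withDensity_eq_integral_toReal_smul (by fun_prop) (by simp)]
  have h2 : ∀ v : ℂ, (ENNReal.ofReal (Real.exp (-‖v‖ ^ 2) / Real.pi)).toReal •
      Complex.exp (L v * Complex.I) =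
      (1 / Real.pi) * Complex.exp (-1 * ‖v‖ ^ 2 + Complex.I * (inner ℝ w v : ℝ)) := by
    intro v
    rw [ENNReal.toReal_ofReal (by positivity), Complex.exp_add, Complex.inner, hL]
    simp only [Complex.real_smul]
    push_cast
    simp
    ring_nf
  simp_rw [h2]
  rw [integral_const_mul, h]
  simp [Complex.finrank_real_complex, Complex.mul_re]
  have : (Real.pi : ℂ) ≠ 0 := by exact_mod_cast Real.pi_ne_zero
  rw [← Complex.ofReal_pow, Complex.sq_norm, Complex.normSq_apply]
  field_simp
  push_cast
  ring_nf

/-! ### Gaussian vectors and their unitary invariance. -/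

/-- The law of a family of independent standard complex Gaussian variables indexed by `ι`. -/
noncomputable abbrev gaussianVector (ι : Type*) [Fintype ι] : Measure (ι → ℂ) :=
  Measure.pi fun _ => stdComplexGaussian

lemma charFunDual_gaussianVector {ι : Type*} [Fintype ι] (L : StrongDual ℝ (ι → ℂ)) (c : ι → ℂ)
    (hL : ∀ x, L x = (star c ⬝ᵥ x).re) :
    charFunDual (gaussianVector ι) L = Complex.exp (-(star c ⬝ᵥ c).re / 4) := by
  classical
  rw [charFunDual_pi]
  have h (i : ι) := charFunDual_stdComplexGaussian
    (L.comp (ContinuousLinearMap.single ℝ (fun _ : ι => ℂ) i)) (c i) (fun z => by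
      simp [hL])
  simp_rw [h]
  rw [← Complex.exp_sum]
  congr 1
  simp only [dotProduct, Complex.re_sum, Pi.star_apply]
  push_cast
  rw [← Finset.sum_div, Finset.sum_neg_distrib]

/-- Characteristic functions test against real-linear functionals; representing these by complex
vectors lets a complex matrix act on them through its adjoint. -/
lemma exists_re_dotProduct {ι : Type*} [Fintype ι] (L : StrongDual ℝ (ι → ℂ)) :
    ∃ c : ι → ℂ, ∀ x, L x = (star c ⬝ᵥ x).re := by
  classical
  refine ⟨fun i => L (Pi.single i 1) + L (Pi.single i Complex.I) * Complex.I, fun x => ?_⟩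
  have hx : x = ∑ i, ((x i).re • (Pi.single i 1 : ι → ℂ) +
      (x i).im • (Pi.single i Complex.I : ι → ℂ)) := by
    ext j
    simp [Pi.single_apply, Finset.sum_apply, Finset.sum_add_distrib]
  conv_lhs => rw [hx]
  simp only [map_sum, map_add, map_smul, dotProduct, Complex.re_sum]
  refine Finset.sum_congr rfl fun i _ => ?_
  simp
  ring

/-- Coisometric linear images of a standard complex Gaussian vector are standard. -/
lemma map_mulVec_gaussianVector {ι κ : Type*} [Fintype ι] [Fintype κ] [DecidableEq κ]
    (M : Matrix κ ι ℂ) (hM : M * Mᴴ = 1) :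
    (gaussianVector ι).map (fun x => M *ᵥ x) = gaussianVector κ := by
  let T : (ι → ℂ) →L[ℝ] (κ → ℂ) := (M.mulVecLin.restrictScalars ℝ).toContinuousLinearMap
  have hT : (fun x => M *ᵥ x) = T := rfl
  have : IsProbabilityMeasure ((gaussianVector ι).map T) :=
    Measure.isProbabilityMeasure_map T.continuous.aemeasurable
  rw [hT]
  refine Measure.ext_of_charFunDual (funext fun L => ?_)
  obtain ⟨c, hc⟩ := exists_re_dotProduct L
  -- Pulling back along `M` replaces `c` by `Mᴴ *ᵥ c`, which has the same norm because `M * Mᴴ = 1`;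
  -- the characteristic function depends only on that norm.
  rw [charFunDual_map, charFunDual_gaussianVector L c hc,
    charFunDual_gaussianVector _ (Mᴴ *ᵥ c) (fun x => ?_)]
  · rw [Matrix.star_mulVec, Matrix.conjTranspose_conjTranspose, Matrix.dotProduct_mulVec,
      Matrix.vecMul_vecMul, hM, Matrix.vecMul_one]
  · rw [Matrix.star_mulVec, Matrix.conjTranspose_conjTranspose, ← Matrix.dotProduct_mulVec]
    exact hc _

/-- Two-sided rotation invariance of a matrix with independent standard complex Gaussian
entries. -/
lemma measurePreserving_mul_mul_gaussianVector {m n p q : Type*} [Fintype m] [Fintype n]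
    [Fintype p] [Fintype q] [DecidableEq m] [DecidableEq q]
    (B : Matrix m n ℂ) (hB : B * Bᴴ = 1) (W : Matrix p q ℂ) (hW : Wᴴ * W = 1) :
    MeasurePreserving
      (fun (x : n × p → ℂ) (e : m × q) => (B * Matrix.of (Function.curry x) * W) e.1 e.2)
      (gaussianVector (n × p)) (gaussianVector (m × q)) := by
  -- After vectorisation `X ↦ B * X * W` is the Kronecker product of `B` and `Wᵀ`, and this is a
  -- coisometry.
  have hM : (Matrix.kroneckerMap (· * ·) B Wᵀ) * (Matrix.kroneckerMap (· * ·) B Wᵀ)ᴴ = 1 := by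
    have h2 : Wᵀ * Wᵀᴴ = 1 := by
      rw [← Matrix.transpose_one, ← hW, Matrix.transpose_mul]; rfl
    rw [Matrix.conjTranspose_kronecker, ← Matrix.mul_kronecker_mul, hB, h2,
      Matrix.one_kronecker_one]
  have heq : (fun (x : n × p → ℂ) (e : m × q) =>
      (B * Matrix.of (Function.curry x) * W) e.1 e.2) =
      fun x => (Matrix.kroneckerMap (· * ·) B Wᵀ) *ᵥ x := by
    funext x e
    simp only [Matrix.mul_apply, Matrix.mulVec, dotProduct, Fintype.sum_prod_type,
      Matrix.kroneckerMap_apply, Matrix.transpose_apply, Finset.sum_mul]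
    rw [Finset.sum_comm]
    refine Finset.sum_congr rfl fun i _ => Finset.sum_congr rfl fun j _ => ?_
    simp [Function.curry]
    ring
  rw [heq]
  refine ⟨?_, map_mulVec_gaussianVector _ hM⟩
  exact (continuous_const.matrix_mulVec continuous_id).measurable

/-- Splitting a standard complex Gaussian vector along a partition of its index set. -/
lemma measurePreserving_gaussianVector_split {α β δ : Type*} [Fintype α] [Fintype β] [Fintype δ]
    (e : α ⊕ β ≃ δ) :
    MeasurePreserving (fun x : δ → ℂ => ((fun a => x (e (.inl a)), fun b => x (e (.inr b))) :
        (α → ℂ) × (β → ℂ)))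
      (gaussianVector δ) ((gaussianVector α).prod (gaussianVector β)) := by
  have h1 := measurePreserving_sumPiEquivProdPi (X := fun _ : α ⊕ β => ℂ)
    (fun _ => stdComplexGaussian)
  have h2 := measurePreserving_piCongrLeft (α := fun _ : α ⊕ β => ℂ)
    (fun _ => stdComplexGaussian) e.symm
  convert! h1.comp h2 using 1
  funext x
  refine Prod.ext (funext fun a => ?_) (funext fun b => ?_) <;>
    simp [MeasurableEquiv.piCongrLeft, Equiv.piCongrLeft, MeasurableEquiv.sumPiEquivProdPi,
      Equiv.sumPiEquivProdPi, Equiv.piCongrLeft']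

/-! ### Gamma law of the squared norm. -/

/-- The squared norm of a standard complex Gaussian vector is Gamma distributed. -/
lemma lintegral_gaussianVector_sum_norm_sq (n : ℕ) {f : ℝ → ENNReal} (hf : Measurable f) :
    ∫⁻ x, f (∑ i, ‖x i‖ ^ 2) ∂(gaussianVector (Fin (n + 1))) =
      ∫⁻ s in Set.Ioi (0 : ℝ), ENNReal.ofReal (s ^ n * Real.exp (-s) / n.factorial) * f s := by
  induction n generalizing f with
  | zero =>
    have h := (measurePreserving_eval (fun _ : Fin 1 => stdComplexGaussian) 0).lintegral_comp
      (f := fun z => f (‖z‖ ^ 2)) (by fun_prop)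
    simp only [Fin.isValue, Nat.reduceAdd, Fin.sum_univ_one, pow_zero, one_mul,
      Nat.factorial_zero, Nat.cast_one, div_one]
    rw [← lintegral_stdComplexGaussian_norm_sq hf, ← h]
  | succ n ih =>
    have h := (measurePreserving_piFinSuccAbove
      (fun _ : Fin (n + 1 + 1) => stdComplexGaussian) 0).lintegral_comp
      (f := fun p => f (‖p.1‖ ^ 2 + ∑ i, ‖p.2 i‖ ^ 2)) (by fun_prop)
    have h' : ∫⁻ x, f (∑ i, ‖x i‖ ^ 2) ∂(gaussianVector (Fin (n + 1 + 1))) =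
        ∫⁻ p, f (‖p.1‖ ^ 2 + ∑ i, ‖p.2 i‖ ^ 2)
          ∂(stdComplexGaussian.prod (gaussianVector (Fin (n + 1)))) := by
      rw [← h]
      refine lintegral_congr fun x => ?_
      rw [Fin.sum_univ_succ]
      rfl
    rw [h', lintegral_prod_symm _ (by fun_prop)]
    have h1 (y : Fin (n + 1) → ℂ) := lintegral_stdComplexGaussian_norm_sq
      (f := fun t => f (t + ∑ i, ‖y i‖ ^ 2)) (by fun_prop)
    simp_rw [h1]
    rw [ih (f := fun s => ∫⁻ t in Set.Ioi (0 : ℝ), ENNReal.ofReal (Real.exp (-t)) * f (t + s))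
      (by fun_prop)]
    -- The substitution `u = t + s` frees `f u` of `s` and merges the exponentials into `exp (-u)`.
    -- After Tonelli, the inner integral of `s ^ n / n!` over `(0, u)` gives the next Gamma density.
    have h2 (s : ℝ) : ∫⁻ t in Set.Ioi (0 : ℝ), ENNReal.ofReal (Real.exp (-t)) * f (t + s) =
        ∫⁻ u, (Set.Ioi s).indicator (fun u => ENNReal.ofReal (Real.exp (s - u)) * f u) u := by
      rw [← lintegral_indicator measurableSet_Ioi,
        ← lintegral_add_right_eq_self ((Set.Ioi s).indicator _) s]
      refine lintegral_congr fun t => ?_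
      by_cases ht : 0 < t <;> simp [Set.indicator, ht]
    simp_rw [h2]
    have h3 (s : ℝ) : ENNReal.ofReal (s ^ n * Real.exp (-s) / n.factorial) *
        ∫⁻ u, (Set.Ioi s).indicator (fun u => ENNReal.ofReal (Real.exp (s - u)) * f u) u =
        ∫⁻ u, ENNReal.ofReal (s ^ n * Real.exp (-s) / n.factorial) *
          (Set.Ioi s).indicator (fun u => ENNReal.ofReal (Real.exp (s - u)) * f u) u := by
      rw [lintegral_const_mul' _ _ ENNReal.ofReal_ne_top]
    simp_rw [h3]
    rw [lintegral_lintegral_swap]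
    · rw [← lintegral_indicator measurableSet_Ioi]
      refine lintegral_congr fun u => ?_
      rcases le_or_gt u 0 with hu | hu
      · rw [Set.indicator_of_notMem (by simpa using hu)]
        rw [setLIntegral_congr_fun (g := fun _ => 0) measurableSet_Ioi]
        · simp
        · intro s hs
          have : ¬ s < u := not_lt.2 (hu.trans (le_of_lt hs))
          simp [this]
      · rw [Set.indicator_of_mem (by simpa using hu)]
        have h4 : ∀ s ∈ Set.Ioi (0 : ℝ), ENNReal.ofReal (s ^ n * Real.exp (-s) / n.factorial) *
            (Set.Ioi s).indicator (fun u => ENNReal.ofReal (Real.exp (s - u)) * f u) u =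
            (Set.Iio u).indicator (fun s => ENNReal.ofReal (s ^ n / n.factorial)) s *
              (ENNReal.ofReal (Real.exp (-u)) * f u) := by
          intro s hs
          have hs : 0 < s := hs
          by_cases hsu : s < u
          · simp only [Set.indicator, Set.mem_Ioi, Set.mem_Iio, hsu, if_true]
            rw [← mul_assoc, ← mul_assoc, ← ENNReal.ofReal_mul (by positivity),
              ← ENNReal.ofReal_mul (by positivity), mul_div_right_comm, mul_assoc,
              ← Real.exp_add]
            ring_nf
          · simp [hsu]
        rw [setLIntegral_congr_fun measurableSet_Ioi h4, lintegral_mul_const _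
          (Measurable.indicator (by fun_prop) measurableSet_Iio),
          setLIntegral_indicator measurableSet_Iio, Set.Iio_inter_Ioi,
          restrict_Ioo_eq_restrict_Ioc,
          ← ofReal_integral_eq_lintegral_ofReal,
          ← intervalIntegral.integral_of_le hu.le]
        · rw [← mul_assoc, ← ENNReal.ofReal_mul]
          · congr 2
            rw [intervalIntegral.integral_div, integral_pow, Nat.factorial_succ]
            push_cast
            have : (n : ℝ) + 1 ≠ 0 := by positivity
            field_simp
            simp
          · exact intervalIntegral.integral_nonneg hu.le fun s hs => by
              have := hs.1
              positivity
        · exact (Continuous.integrableOn_Ioc (by fun_prop))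
        · refine (ae_restrict_iff' measurableSet_Ioc).2 (ae_of_all _ fun s hs => ?_)
          have := hs.1
          change 0 ≤ s ^ n / _
          positivity
    · have hS : MeasurableSet {p : ℝ × ℝ | p.1 < p.2} :=
        measurableSet_lt measurable_fst measurable_snd
      have h5 : (Function.uncurry fun s u : ℝ =>
          ENNReal.ofReal (s ^ n * Real.exp (-s) / n.factorial) *
          (Set.Ioi s).indicator (fun u => ENNReal.ofReal (Real.exp (s - u)) * f u) u) =
          fun p : ℝ × ℝ => ENNReal.ofReal (p.1 ^ n * Real.exp (-p.1) / n.factorial) *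
            ({p : ℝ × ℝ | p.1 < p.2}).indicator
              (fun p => ENNReal.ofReal (Real.exp (p.1 - p.2)) * f p.2) p := by
        funext p
        simp [Function.uncurry, Set.indicator]
      rw [h5]
      exact (Measurable.mul (by fun_prop)
        (Measurable.indicator (by fun_prop) hS)).aemeasurable

/-- The law of a Gamma variable as a push-forward. -/
lemma map_sum_norm_sq_gaussianVector (n : ℕ) :
    (gaussianVector (Fin (n + 1))).map (fun x => ∑ i, ‖x i‖ ^ 2) =
      (volume.restrict (Set.Ioi 0)).withDensity
        (fun s : ℝ => ENNReal.ofReal (s ^ n * Real.exp (-s) / n.factorial)) := by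
  refine Measure.ext_of_lintegral _ fun f hf => ?_
  rw [lintegral_map hf (by fun_prop), lintegral_gaussianVector_sum_norm_sq n hf,
    lintegral_withDensity_eq_lintegral_mul _ (by fun_prop) hf]
  rfl

/-! ### Logarithmic means. -/

/-- `D` is a.e. positive, and `log D` is integrable with integral `c`. -/
structure HasLogMean {α : Type*} [MeasurableSpace α] (μ : Measure α) (D : α → ℝ) (c : ℝ) :
    Prop where
  aemeasurable : AEMeasurable D μ
  pos : ∀ᵐ a ∂μ, 0 < D a
  integrable : Integrable (fun a => Real.log (D a)) μ
  integral_eq : ∫ a, Real.log (D a) ∂μ = c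

lemma hasLogMean_map_iff {α β : Type*} [MeasurableSpace α] [MeasurableSpace β] {μ : Measure α}
    {Z : α → β} (hZ : AEMeasurable Z μ) {D : β → ℝ} (hD : Measurable D) {c : ℝ} :
    HasLogMean (μ.map Z) D c ↔ HasLogMean μ (fun a => D (Z a)) c := by
  have hlog : AEStronglyMeasurable (fun b => Real.log (D b)) (μ.map Z) :=
    (Real.measurable_log.comp hD).aestronglyMeasurable
  constructor
  · rintro ⟨-, h2, h3, h4⟩
    refine ⟨hD.comp_aemeasurable hZ, ae_of_ae_map hZ h2, ?_, ?_⟩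
    · exact (integrable_map_measure hlog hZ).1 h3
    · rw [← h4, integral_map hZ hlog]
  · rintro ⟨-, h2, h3, h4⟩
    refine ⟨hD.aemeasurable, (ae_map_iff hZ (measurableSet_lt measurable_const hD)).2 h2, ?_, ?_⟩
    · exact (integrable_map_measure hlog hZ).2 h3
    · rw [← h4, integral_map hZ hlog]

/-- If, for almost every `a`, the variable `D (a, ·)` is distributed as `u a * W`, then the
logarithmic means of `u` and `W` add up to that of `D`. -/
lemma HasLogMean.of_prod {α β γ : Type*} [MeasurableSpace α] [MeasurableSpace β]
    [MeasurableSpace γ] {μ : Measure α} {ν : Measure β} {ρ : Measure γ} [IsProbabilityMeasure μ]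
    [IsProbabilityMeasure ν] [IsProbabilityMeasure ρ] {u : α → ℝ} {W : γ → ℝ} {D : α × β → ℝ}
    {c₁ c₂ : ℝ} (hu : HasLogMean μ u c₁) (hW : HasLogMean ρ W c₂) (hD : Measurable D)
    (h : ∀ᵐ a ∂μ, IdentDistrib (fun b => D (a, b)) (fun c => u a * W c) ν ρ) :
    HasLogMean (μ.prod ν) D (c₁ + c₂) := by
  -- The fibrewise mean is what Fubini integrates; the fibrewise `L¹` bound, itself integrable in
  -- `a`, is what makes `log D` jointly integrable.
  have key : ∀ᵐ a ∂μ, HasLogMean ν (fun b => D (a, b)) (Real.log (u a) + c₂) ∧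
      ∫ b, ‖Real.log (D (a, b))‖ ∂ν ≤ |Real.log (u a)| + ∫ c, |Real.log (W c)| ∂ρ := by
    filter_upwards [h, hu.pos] with a ha hua
    have hlog : (fun c => Real.log (u a * W c)) =ᵐ[ρ]
        fun c => Real.log (u a) + Real.log (W c) := by
      filter_upwards [hW.pos] with c hc
      rw [Real.log_mul hua.ne' hc.ne']
    have hint : Integrable (fun c => Real.log (u a * W c)) ρ :=
      ((integrable_const _).add hW.integrable).congr hlog.symm
    refine ⟨⟨ha.aemeasurable_fst, ?_, ?_, ?_⟩, ?_⟩
    · refine ha.symm.ae_mem_snd measurableSet_Ioi (?_ : ∀ᵐ c ∂ρ, u a * W c ∈ Set.Ioi 0)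
      filter_upwards [hW.pos] with c hc using mul_pos hua hc
    · exact (ha.comp Real.measurable_log).integrable_iff.2 hint
    · refine (ha.comp Real.measurable_log).integral_eq.trans ?_
      simp only [Function.comp_def]
      rw [integral_congr_ae hlog, integral_add (integrable_const _) hW.integrable,
        hW.integral_eq]
      simp
    · refine (ha.comp (Real.measurable_log.norm)).integral_eq.trans_le ?_
      calc ∫ c, ‖Real.log (u a * W c)‖ ∂ρ
          ≤ ∫ c, (|Real.log (u a)| + |Real.log (W c)|) ∂ρ := by
            refine integral_mono_ae hint.norm
              ((integrable_const _).add hW.integrable.norm) ?_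
            filter_upwards [hlog] with c hc
            rw [hc]
            exact abs_add_le _ _
        _ = _ := by
            rw [integral_add (integrable_const _) hW.integrable.abs]
            simp
  have hlogm : AEStronglyMeasurable (fun p => Real.log (D p)) (μ.prod ν) :=
    (Real.measurable_log.comp hD).aestronglyMeasurable
  have hint : Integrable (fun p => Real.log (D p)) (μ.prod ν) := by
    rw [integrable_prod_iff hlogm]
    refine ⟨key.mono fun a ha => ha.1.integrable, ?_⟩
    refine Integrable.mono' (hu.integrable.norm.add
      (integrable_const (∫ c, |Real.log (W c)| ∂ρ))) hlogm.norm.integral_prod_right' ?_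
    filter_upwards [key] with a ha
    rw [Real.norm_of_nonneg (integral_nonneg fun _ => norm_nonneg _)]
    exact ha.2
  refine ⟨hD.aemeasurable, ?_, hint, ?_⟩
  · rw [Measure.ae_prod_iff_ae_ae (measurableSet_lt measurable_const hD)]
    exact key.mono fun a ha => ha.1.pos
  · rw [integral_prod _ hint, integral_congr_ae (key.mono fun a ha => ha.1.integral_eq),
      integral_add hu.integrable (integrable_const _), hu.integral_eq]
    simp

/-- Differentiating the Mellin transform of `exp (-t)` under the integral inserts `log t`, so the
value is the derivative of Gamma at `n + 1`. -/
lemma integral_gamma_log (n : ℕ) :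
    IntegrableOn (fun t : ℝ => t ^ n * Real.exp (-t) * Real.log t) (Set.Ioi 0) ∧
      ∫ t in Set.Ioi (0 : ℝ), t ^ n * Real.exp (-t) * Real.log t =
        n.factorial * (-Real.eulerMascheroniConstant + harmonic n) := by
  have hre : 0 < ((n : ℂ) + 1).re := by simp; positivity
  have hderiv : HasDerivAt Complex.GammaIntegral
      (n.factorial * (-Real.eulerMascheroniConstant + harmonic n)) ((n : ℂ) + 1) := by
    refine (Complex.hasDerivAt_Gamma_nat n).congr_of_eventuallyEq ?_
    filter_upwards [Complex.continuous_re.continuousAt.eventually (lt_mem_nhds hre)] with s hs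
    exact (Complex.Gamma_eq_integral hs).symm
  -- The exponents only have to enclose the real part `n + 1` strictly: `b = 0` since the function
  -- is bounded near zero, and `a = n + 2` thanks to exponential decay.
  have hM := mellin_hasDerivAt_of_isBigO_rpow (E := ℂ) (f := fun t => (Real.exp (-t) : ℂ))
    (a := (n : ℝ) + 2) (b := 0) (s := (n : ℂ) + 1)
    ((by fun_prop : Continuous fun t : ℝ => (Real.exp (-t) : ℂ)).continuousOn.locallyIntegrableOn
      measurableSet_Ioi)
    (by
      rw [← Asymptotics.isBigO_norm_left]
      simp_rw [Complex.norm_real, Asymptotics.isBigO_norm_left]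
      simpa only [neg_one_mul] using (isLittleO_exp_neg_mul_rpow_atTop zero_lt_one _).isBigO)
    (by simp)
    (by
      simp_rw [neg_zero, Real.rpow_zero]
      refine Asymptotics.isBigO_const_of_tendsto (?_ : Tendsto _ _ (𝓝 (1 : ℂ))) one_ne_zero
      rw [(by simp : (1 : ℂ) = Real.exp (-0))]
      exact (by fun_prop : Continuous fun t : ℝ => (Real.exp (-t) : ℂ)).continuousWithinAt)
    hre
  rw [← Complex.GammaIntegral_eq_mellin] at hM
  have hval := hM.2.unique hderiv
  have heq (t : ℝ) : (t : ℂ) ^ ((n : ℂ) + 1 - 1) • Real.log t • (Real.exp (-t) : ℂ) =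
      ((t ^ n * Real.exp (-t) * Real.log t : ℝ) : ℂ) := by
    rw [add_sub_cancel_right, Complex.cpow_natCast]
    simp only [smul_eq_mul, Complex.real_smul]
    push_cast
    ring
  constructor
  · have h := hM.1
    simp only [MellinConvergent, heq] at h
    exact h.re
  · simp only [mellin, heq] at hval
    rw [integral_complex_ofReal] at hval
    exact_mod_cast hval

lemma hasLogMean_sum_norm_sq (n : ℕ) :
    HasLogMean (gaussianVector (Fin (n + 1))) (fun x => ∑ i, ‖x i‖ ^ 2)
      (harmonic n - Real.eulerMascheroniConstant) := by
  refine (hasLogMean_map_iff (Z := fun x : Fin (n + 1) → ℂ => ∑ i, ‖x i‖ ^ 2)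
    (Measurable.aemeasurable (by fun_prop))
    measurable_id).1 ?_
  rw [map_sum_norm_sq_gaussianVector]
  have hmeas : Measurable fun s : ℝ =>
      ENNReal.ofReal (s ^ n * Real.exp (-s) / n.factorial) := by fun_prop
  have hlt (μ : Measure ℝ) : ∀ᵐ s ∂μ,
      ENNReal.ofReal (s ^ n * Real.exp (-s) / n.factorial) < ⊤ :=
    ae_of_all _ fun s => ENNReal.ofReal_lt_top
  obtain ⟨h1, h2⟩ := integral_gamma_log n
  have heq : ∀ s ∈ Set.Ioi (0 : ℝ),
      (ENNReal.ofReal (s ^ n * Real.exp (-s) / n.factorial)).toReal • Real.log (id s) =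
      (s ^ n * Real.exp (-s) * Real.log s) * (1 / n.factorial) := by
    intro s hs
    have hs : 0 < s := hs
    rw [ENNReal.toReal_ofReal (by positivity), smul_eq_mul, id]
    ring
  refine ⟨aemeasurable_id, ?_, ?_, ?_⟩
  · exact (withDensity_absolutelyContinuous _ _).ae_le (ae_restrict_mem measurableSet_Ioi)
  · rw [integrable_withDensity_iff_integrable_smul' hmeas (hlt _)]
    exact (integrableOn_congr_fun heq measurableSet_Ioi).2 (h1.mul_const _)
  · rw [integral_withDensity_eq_integral_toReal_smul hmeas (hlt _),
      setIntegral_congr_fun measurableSet_Ioi heq, integral_mul_const, h2]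
    have : (n.factorial : ℝ) ≠ 0 := by positivity
    field_simp
    ring

/-! ### Gram determinants of Gaussian matrices. -/

/-- The Gram determinant `det (Aᴴ A)`, as a real number. -/
noncomputable def gramDet {m n : Type*} [Fintype m] [Fintype n] [DecidableEq n]
    (A : Matrix m n ℂ) : ℝ :=
  (Aᴴ * A).det.re

lemma measurable_gramDet {m n α : Type*} [Fintype m] [Fintype n] [DecidableEq n]
    [MeasurableSpace α] {A : α → Matrix m n ℂ} (hA : ∀ i j, Measurable fun a => A a i j) :
    Measurable fun a => gramDet (A a) := by
  simp only [gramDet, Matrix.det_apply, Matrix.mul_apply, Matrix.conjTranspose_apply]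
  fun_prop

lemma gramDet_mul {m n : Type*} [Fintype m] [Fintype n] [DecidableEq n]
    (A : Matrix m n ℂ) (T : Matrix n n ℂ) : gramDet (A * T) = gramDet T * gramDet A := by
  have h : ((A * T)ᴴ * (A * T)).det = ((Complex.normSq T.det : ℝ) : ℂ) * (Aᴴ * A).det := by
    rw [Matrix.conjTranspose_mul, Matrix.mul_assoc, ← Matrix.mul_assoc Aᴴ, Matrix.det_mul,
      Matrix.det_mul, Matrix.det_conjTranspose, Complex.normSq_eq_conj_mul_self]
    simp only [starRingEnd_apply]
    ring
  have hT : (Tᴴ * T).det = ((Complex.normSq T.det : ℝ) : ℂ) := by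
    rw [Matrix.det_mul, Matrix.det_conjTranspose, Complex.normSq_eq_conj_mul_self]
    simp only [starRingEnd_apply]
  rw [gramDet, gramDet, gramDet, h, hT, Complex.re_ofReal_mul, Complex.ofReal_re]

/-- The coisometry whose kernel is the line spanned by a nonzero vector `g`. -/
lemma exists_coisometry_orthogonal {n : ℕ} (g : Fin (n + 1) → ℂ) (hg : 0 < ∑ i, ‖g i‖ ^ 2) :
    ∃ P : Matrix (Fin n) (Fin (n + 1)) ℂ, P * Pᴴ = 1 ∧
      Pᴴ * P = 1 - (((∑ i, ‖g i‖ ^ 2 : ℝ) : ℂ)⁻¹) • Matrix.vecMulVec g (star g) := by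
  set u : ℝ := ∑ i, ‖g i‖ ^ 2 with hu
  let v : EuclideanSpace ℂ (Fin (n + 1)) := WithLp.toLp 2 (((√u : ℝ) : ℂ)⁻¹ • g)
  have hv : ‖v‖ = 1 := by
    have h : ‖(WithLp.toLp 2 g : EuclideanSpace ℂ (Fin (n + 1)))‖ = √u := by
      rw [EuclideanSpace.norm_eq]
    have h' : v = ((√u : ℝ) : ℂ)⁻¹ • (WithLp.toLp 2 g : EuclideanSpace ℂ (Fin (n + 1))) := rfl
    rw [h', norm_smul, h, norm_inv, Complex.norm_real, Real.norm_of_nonneg (Real.sqrt_nonneg _),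
      inv_mul_cancel₀ (Real.sqrt_pos.2 hg).ne']
  obtain ⟨b, hb⟩ := Orthonormal.exists_orthonormalBasis_extension_of_card_eq (𝕜 := ℂ)
    (E := EuclideanSpace ℂ (Fin (n + 1))) (ι := Fin (n + 1)) (by simp) (v := fun _ => v)
    (s := {0}) (by
      constructor
      · intro i; exact hv
      · intro i j hij; exact absurd (Subsingleton.elim i j) hij)
  have hb0 : b 0 = v := hb 0 rfl
  -- The rows of this unitary are the conjugated basis vectors. Row `0` carries the direction of
  -- `g`; deleting it leaves the coisometry sought.
  let U : Matrix (Fin (n + 1)) (Fin (n + 1)) ℂ := Matrix.of fun i j => star (b i j)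
  have hU : U * Uᴴ = 1 := by
    ext i k
    have := orthonormal_iff_ite.1 b.orthonormal i k
    rw [Matrix.mul_apply, Matrix.one_apply, ← this, PiLp.inner_apply]
    refine Finset.sum_congr rfl fun j _ => ?_
    simp [U, mul_comm]
  have hU' : Uᴴ * U = 1 := mul_eq_one_comm.1 hU
  refine ⟨U.submatrix Fin.succ id, ?_, ?_⟩
  · ext i k
    have := congrFun (congrFun hU i.succ) k.succ
    simp only [Matrix.mul_apply, Matrix.conjTranspose_apply, Matrix.one_apply,
      Fin.succ_inj] at this
    simpa only [Matrix.mul_apply, Matrix.conjTranspose_apply, Matrix.one_apply,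
      Matrix.submatrix_apply, id] using this
  · ext j k
    have h := congrFun (congrFun hU' j) k
    rw [Matrix.mul_apply, Fin.sum_univ_succ] at h
    have h0 : Uᴴ j 0 * U 0 k = (u : ℂ)⁻¹ * (g j * star (g k)) := by
      have hs : ((√u : ℝ) : ℂ) * ((√u : ℝ) : ℂ) = u := by
        rw [← Complex.ofReal_mul, Real.mul_self_sqrt hg.le]
      rw [← hs]
      simp [U, hb0, v]
      ring
    rw [h0] at h
    rw [Matrix.sub_apply, ← h]
    simp [Matrix.mul_apply, Matrix.vecMulVec_apply]

/-- Schur complement: the pivot of the block Gram matrix is `‖g‖²`, and the complement is `Yᴴ * (1 -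
g g† / ‖g‖²) * Y = (P * Y)ᴴ * (P * Y)`. -/
lemma gramDet_fromCols {m n : Type*} [Fintype m] [DecidableEq m] [Fintype n] [DecidableEq n]
    {l : Type*} [Fintype l] (g : m → ℂ) (hg : 0 < ∑ i, ‖g i‖ ^ 2) (Y : Matrix m n ℂ)
    (P : Matrix l m ℂ)
    (hP : Pᴴ * P = 1 - (((∑ i, ‖g i‖ ^ 2 : ℝ) : ℂ)⁻¹) • Matrix.vecMulVec g (star g)) :
    gramDet (Matrix.fromCols (Matrix.replicateCol Unit g) Y) =
      (∑ i, ‖g i‖ ^ 2) * gramDet (P * Y) := by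
  set u : ℝ := ∑ i, ‖g i‖ ^ 2 with hu
  have hu0 : (u : ℂ) ≠ 0 := by exact_mod_cast hg.ne'
  set c := Matrix.replicateCol Unit g
  have hc : cᴴ * c = (u : ℂ) • (1 : Matrix Unit Unit ℂ) := by
    ext i j
    simp [c, Matrix.mul_apply, hu, ← Complex.normSq_eq_conj_mul_self, Complex.normSq_eq_norm_sq]
  have hcinv : (cᴴ * c)⁻¹ = (u : ℂ)⁻¹ • (1 : Matrix Unit Unit ℂ) := by
    apply Matrix.inv_eq_right_inv
    rw [hc, smul_mul_smul_comm, mul_inv_cancel₀ hu0, one_smul, Matrix.one_mul]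
  have hdet : (cᴴ * c).det = u := by rw [hc]; simp
  let _ : Invertible (cᴴ * c) :=
    Matrix.invertibleOfIsUnitDet _ (by rw [hdet]; exact hu0.isUnit)
  have hcc : c * cᴴ = Matrix.vecMulVec g (star g) := by
    ext i j
    simp [c, Matrix.mul_apply, Matrix.vecMulVec_apply]
  rw [gramDet, Matrix.conjTranspose_fromCols_eq_fromRows_conjTranspose,
    Matrix.fromRows_mul_fromCols, Matrix.det_fromBlocks₁₁, hdet, Complex.re_ofReal_mul,
    Matrix.invOf_eq_nonsing_inv, hcinv, gramDet]
  congr 3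
  rw [Matrix.conjTranspose_mul, Matrix.mul_assoc Yᴴ Pᴴ, ← Matrix.mul_assoc Pᴴ, hP, ← hcc,
    Matrix.sub_mul, Matrix.mul_sub, Matrix.one_mul, Matrix.mul_smul, Matrix.mul_one,
    Matrix.smul_mul, Matrix.smul_mul, Matrix.mul_smul]
  simp only [Matrix.mul_assoc]

lemma gramDet_reindex {m n l : Type*} [Fintype m] [Fintype n] [DecidableEq n] [Fintype l]
    [DecidableEq l] (A : Matrix m n ℂ) (e : l ≃ n) :
    gramDet (A.submatrix id e) = gramDet A := by
  rw [gramDet, gramDet, ← Matrix.det_submatrix_equiv_self e (Aᴴ * A)]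
  rfl

/-- Logarithmic mean of the Gram determinant of a Gaussian matrix (complex Wishart matrix). -/
lemma hasLogMean_gramDet_gaussian (m n : ℕ) (hmn : m ≤ n) :
    HasLogMean (gaussianVector (Fin n × Fin m)) (fun x => gramDet (Matrix.of (Function.curry x)))
      (∑ l ∈ Finset.range m, (harmonic (n - 1 - l) - Real.eulerMascheroniConstant)) := by
  induction m generalizing n with
  | zero =>
    have h (x : Fin n × Fin 0 → ℂ) : gramDet (Matrix.of (Function.curry x)) = 1 := by
      simp [gramDet]
    simp only [h]
    constructor <;> simp
  | succ m ih =>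
    obtain ⟨n, rfl⟩ : ∃ k, n = k + 1 := ⟨n - 1, by omega⟩
    let e₀ : Unit ⊕ Fin m ≃ Fin (m + 1) :=
      { toFun := Sum.elim (fun _ => 0) Fin.succ
        invFun := Fin.cases (Sum.inl ()) Sum.inr
        left_inv := by rintro (_ | j) <;> rfl
        right_inv := by intro j; refine Fin.cases rfl (fun _ => rfl) j }
    let e : Fin (n + 1) ⊕ (Fin (n + 1) × Fin m) ≃ Fin (n + 1) × Fin (m + 1) :=
      { toFun := Sum.elim (fun i => (i, 0)) (fun p => (p.1, p.2.succ))
        invFun := fun p => Fin.cases (Sum.inl p.1) (fun j => Sum.inr (p.1, j)) p.2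
        left_inv := by rintro (_ | ⟨i, j⟩) <;> rfl
        right_inv := by
          rintro ⟨i, j⟩
          refine Fin.cases rfl (fun _ => rfl) j }
    let D : (Fin (n + 1) → ℂ) × (Fin (n + 1) × Fin m → ℂ) → ℝ := fun p =>
      gramDet (Matrix.fromCols (Matrix.replicateCol Unit p.1) (Matrix.of (Function.curry p.2)))
    have hDmeas : Measurable D := by
      refine measurable_gramDet fun i j => ?_
      rcases j with _ | j
      · exact (measurable_pi_apply i).comp measurable_fst
      · exact (measurable_pi_apply (i, j)).comp measurable_snd
    have hsplit := measurePreserving_gaussianVector_split e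
    have hD : HasLogMean ((gaussianVector (Fin (n + 1))).prod
        (gaussianVector (Fin (n + 1) × Fin m))) D
        ((harmonic n - Real.eulerMascheroniConstant) +
          ∑ l ∈ Finset.range m, (harmonic (n - 1 - l) - Real.eulerMascheroniConstant)) := by
      -- Condition on the first column `g`. The remaining columns, projected off `g`, form an `n ×
      -- m` Gaussian matrix whose law does not depend on `g`, so the induction hypothesis supplies
      -- the second factor.
      refine (hasLogMean_sum_norm_sq n).of_prod (ih n (by omega)) hDmeas ?_
      filter_upwards [(hasLogMean_sum_norm_sq n).pos] with g hg
      obtain ⟨P, hP1, hP2⟩ := exists_coisometry_orthogonal g hg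
      have hT := measurePreserving_mul_mul_gaussianVector P hP1 (1 : Matrix (Fin m) (Fin m) ℂ)
        (by simp)
      have hW : Measurable fun c : Fin n × Fin m → ℂ =>
          (∑ i, ‖g i‖ ^ 2) * gramDet (Matrix.of (Function.curry c)) :=
        (measurable_gramDet fun i j => measurable_pi_apply (i, j)).const_mul _
      have hDg : (fun y => D (g, y)) = fun y => (∑ i, ‖g i‖ ^ 2) *
          gramDet (Matrix.of (Function.curry (fun e : Fin n × Fin m =>
            (P * Matrix.of (Function.curry y) * (1 : Matrix (Fin m) (Fin m) ℂ)) e.1 e.2))) := by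
        funext y
        rw [show D (g, y) = _ from gramDet_fromCols g hg _ P hP2, Matrix.mul_one]
        rfl
      refine ⟨(hDmeas.comp measurable_prodMk_left).aemeasurable, hW.aemeasurable, ?_⟩
      rw [hDg, ← hT.map_eq, Measure.map_map hW hT.measurable]
      rfl
    rw [← hsplit.map_eq] at hD
    have := (hasLogMean_map_iff hsplit.aemeasurable hDmeas).1 hD
    rw [Finset.sum_range_succ']
    convert! this using 1
    · funext x
      rw [← gramDet_reindex _ e₀]
      congr 1
      ext i j
      rcases j with _ | j <;> rfl
    · rw [add_comm]
      refine congrArg₂ (· + ·) (by simp) (Finset.sum_congr rfl fun l _ => ?_)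
      · rw [show n + 1 - 1 - (l + 1) = n - 1 - l by omega]

/-! ### Products with Gaussian matrices. -/

-- Any `T` with `Tᴴ * T = Aᴴ * A` is invertible when the Gram determinant is nonzero, and `W = A *
-- T⁻¹` is then an isometry. It reduces multiplication by `A` to the rotation-invariant case.
open scoped ComplexOrder MatrixOrder in
lemma exists_isometry_mul {m n : Type*} [Fintype m] [Fintype n] [DecidableEq n]
    (A : Matrix m n ℂ) (hA : 0 < gramDet A) :
    ∃ (W : Matrix m n ℂ) (T : Matrix n n ℂ), A = W * T ∧ Wᴴ * W = 1 := by
  have hpsd := Matrix.posSemidef_conjTranspose_mul_self A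
  obtain ⟨T, hT⟩ : ∃ T : Matrix n n ℂ, Aᴴ * A = Tᴴ * T := by
    exact CStarAlgebra.nonneg_iff_eq_star_mul_self.1 hpsd.nonneg
  have hdet : IsUnit T.det := by
    rw [isUnit_iff_ne_zero]
    intro h
    rw [gramDet, hT, Matrix.det_mul, h] at hA
    simp at hA
  refine ⟨A * T⁻¹, T, ?_, ?_⟩
  · rw [Matrix.mul_assoc, Matrix.nonsing_inv_mul _ hdet, Matrix.mul_one]
  · rw [Matrix.conjTranspose_mul, Matrix.mul_assoc, ← Matrix.mul_assoc Aᴴ, hT, Matrix.mul_assoc,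
      Matrix.mul_nonsing_inv _ hdet, Matrix.mul_one, ← Matrix.conjTranspose_mul,
      Matrix.mul_nonsing_inv _ hdet, Matrix.conjTranspose_one]

/-- Multiplication by an independent Gaussian matrix. -/
lemma HasLogMean.gramDet_mul_gaussian {α : Type*} [MeasurableSpace α] {μ : Measure α}
    [IsProbabilityMeasure μ] {m n p : ℕ} (hmp : m ≤ p) {A : α → Matrix (Fin n) (Fin m) ℂ}
    (hAm : ∀ i j, Measurable fun a => A a i j) {c : ℝ}
    (hA : HasLogMean μ (fun a => gramDet (A a)) c) :
    HasLogMean (μ.prod (gaussianVector (Fin p × Fin n)))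
      (fun z => gramDet (Matrix.of (Function.curry z.2) * A z.1))
      (c + ∑ l ∈ Finset.range m, (harmonic (p - 1 - l) - Real.eulerMascheroniConstant)) := by
  have hD : Measurable fun z : α × (Fin p × Fin n → ℂ) =>
      gramDet (Matrix.of (Function.curry z.2) * A z.1) := by
    refine measurable_gramDet fun i j => ?_
    simp only [Matrix.mul_apply, Matrix.of_apply, Function.curry]
    refine Finset.measurable_sum _ fun k _ => Measurable.mul ?_ ?_
    · exact (measurable_pi_apply (i, k)).comp measurable_snd
    · exact (hAm k j).comp measurable_fst
  refine hA.of_prod (hasLogMean_gramDet_gaussian m p hmp) hD ?_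
  filter_upwards [hA.pos] with a ha
  -- For Gaussian `X`, `X * A = (X * W) * T`: the isometry is absorbed into the law of `X`, and `T`
  -- contributes the scalar `gramDet T = gramDet (A a)`.
  obtain ⟨W, T, hWT, hW⟩ := exists_isometry_mul (A a) ha
  have hP := measurePreserving_mul_mul_gaussianVector (1 : Matrix (Fin p) (Fin p) ℂ) (by simp)
    W hW
  have hWm : Measurable fun c : Fin p × Fin m → ℂ =>
      gramDet (A a) * gramDet (Matrix.of (Function.curry c)) :=
    (measurable_gramDet fun i j => measurable_pi_apply (i, j)).const_mul _
  have hAT : gramDet (A a) = gramDet T := by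
    rw [hWT, gramDet_mul]
    simp [gramDet, hW]
  have hDg : (fun y : Fin p × Fin n → ℂ => gramDet (Matrix.of (Function.curry y) * A a)) =
      fun y => gramDet (A a) * gramDet (Matrix.of (Function.curry (fun e : Fin p × Fin m =>
        ((1 : Matrix (Fin p) (Fin p) ℂ) * Matrix.of (Function.curry y) * W) e.1 e.2))) := by
    funext y
    conv_lhs => rw [hWT, ← Matrix.mul_assoc, gramDet_mul, ← hAT]
    rw [Matrix.one_mul]
    rfl
  refine ⟨(hD.comp measurable_prodMk_left).aemeasurable, hWm.aemeasurable, ?_⟩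
  rw [hDg, ← hP.map_eq, Measure.map_map hWm hP.measurable]
  rfl

/-! ### The Rayleigh chain. -/

lemma productChannel_congr {Ω Ω' : Type*} {N : ℕ → ℕ}
    {Q : (k : ℕ) → Ω → Matrix (Fin (N (k + 1))) (Fin (N k)) ℂ}
    {Q' : (k : ℕ) → Ω' → Matrix (Fin (N (k + 1))) (Fin (N k)) ℂ} {ω : Ω} {ω' : Ω'} {k : ℕ}
    (h : ∀ j < k, Q j ω = Q' j ω') : productChannel N Q k ω = productChannel N Q' k ω' := by
  induction k with
  | zero => rfl
  | succ k ih =>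
    rw [productChannel, productChannel, h k k.lt_succ_self,
      ih fun j hj => h j (hj.trans k.lt_succ_self)]

lemma measurable_productChannel {Ω : Type*} [MeasurableSpace Ω] {N : ℕ → ℕ}
    {Q : (k : ℕ) → Ω → Matrix (Fin (N (k + 1))) (Fin (N k)) ℂ}
    (h : ∀ k i j, Measurable fun ω => Q k ω i j) (k : ℕ) (i : Fin (N k)) (j : Fin (N 0)) :
    Measurable fun ω => productChannel N Q k ω i j := by
  induction k with
  | zero => exact measurable_const
  | succ k ih =>
    simp only [productChannel, Matrix.mul_apply]
    exact Finset.measurable_sum _ fun l _ => (h k i l).mul (ih l)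

/-- The set of matrix entries of the first `K` tiers. -/
abbrev ChannelEntry (K : ℕ) (N : ℕ → ℕ) : Type :=
  Σ k : Fin K, Fin (N ((k : ℕ) + 1)) × Fin (N (k : ℕ))

/-- The channel matrices whose entries are the coordinates of `q`. -/
def entryMatrix (K : ℕ) (N : ℕ → ℕ) (k : ℕ) (q : ChannelEntry K N → ℂ) :
    Matrix (Fin (N (k + 1))) (Fin (N k)) ℂ :=
  -- The value `0` beyond tier `K` never enters the products used; it keeps every tier measurable.
  Matrix.of fun i j => if h : k < K then q ⟨⟨k, h⟩, (i, j)⟩ else 0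

lemma measurable_entryMatrix (K : ℕ) (N : ℕ → ℕ) (k : ℕ) (i : Fin (N (k + 1))) (j : Fin (N k)) :
    Measurable fun q => entryMatrix K N k q i j := by
  by_cases h : k < K
  · simp only [entryMatrix, Matrix.of_apply, h, dif_pos]
    exact measurable_pi_apply _
  · simp only [entryMatrix, Matrix.of_apply, h, dif_neg, not_false_eq_true]
    exact measurable_const

section Chain

variable {Ω : Type*} [MeasurableSpace Ω] {P : Measure Ω} {K : ℕ} {N : ℕ → ℕ}
  {Q : (k : ℕ) → Ω → Matrix (Fin (N (k + 1))) (Fin (N k)) ℂ}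

lemma IsRayleighChain.aemeasurable_entry (hQ : IsRayleighChain P K N Q) (e : ChannelEntry K N) :
    AEMeasurable (fun ω => Q (e.1 : ℕ) ω e.2.1 e.2.2) P :=
  (hQ.law e.1 e.1.2 e.2.1 e.2.2).aemeasurable

lemma IsRayleighChain.hasLaw_matrix [IsProbabilityMeasure P] (hQ : IsRayleighChain P K N Q)
    {k : ℕ} (hk : k < K) :
    HasLaw (fun ω (e : Fin (N (k + 1)) × Fin (N k)) => Q k ω e.1 e.2)
      (gaussianVector (Fin (N (k + 1)) × Fin (N k))) P := by
  have hinj : Function.Injective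
      (fun e : Fin (N (k + 1)) × Fin (N k) => (⟨⟨k, hk⟩, e⟩ : ChannelEntry K N)) :=
    fun a b h => by simpa using h
  exact (hQ.indep.precomp hinj).hasLaw_pi fun e => hQ.law k hk e.1 e.2

lemma IsRayleighChain.hasLogMean_gramDet [IsProbabilityMeasure P] (hQ : IsRayleighChain P K N Q)
    (hN : ∀ k ≤ K, N 0 ≤ N k) {k : ℕ} (hk : k ≤ K) :
    HasLogMean P (fun ω => gramDet (productChannel N Q k ω))
      (∑ j ∈ Finset.range k, ∑ l ∈ Finset.range (N 0),
        (harmonic (N (j + 1) - 1 - l) - Real.eulerMascheroniConstant)) := by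
  induction k with
  | zero =>
    have h (ω : Ω) : gramDet (productChannel N Q 0 ω) = 1 := by
      simp [gramDet, productChannel]
    simp only [h]
    constructor <;> simp
  | succ k ih =>
    have hkK : k < K := hk
    -- `S` indexes the entries of the earlier tiers and `T` those of tier `k`. Disjointness makes
    -- the product so far, a function of `S`, independent of the next matrix.
    let S : Finset (ChannelEntry K N) := Finset.univ.filter fun e => (e.1 : ℕ) < k
    let T : Finset (ChannelEntry K N) := Finset.univ.filter fun e => (e.1 : ℕ) = k
    have hST : Disjoint S T := by
      rw [Finset.disjoint_left]
      intro e hS hT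
      simp only [S, T, Finset.mem_filter, Finset.mem_univ, true_and] at hS hT
      omega
    let Y : Ω → (S → ℂ) := fun ω e => Q (e.1.1 : ℕ) ω e.1.2.1 e.1.2.2
    let V : Ω → (Fin (N (k + 1)) × Fin (N k) → ℂ) := fun ω e => Q k ω e.1 e.2
    let F : (S → ℂ) → Matrix (Fin (N k)) (Fin (N 0)) ℂ := fun y =>
      productChannel N (entryMatrix K N) k fun e => if h : e ∈ S then y ⟨e, h⟩ else 0
    have hFm (i j) : Measurable fun y => F y i j := by
      refine (measurable_productChannel (measurable_entryMatrix K N) k i j).comp ?_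
      refine measurable_pi_lambda _ fun e => ?_
      by_cases h : e ∈ S
      · simp only [h, dif_pos]; exact measurable_pi_apply _
      · simp only [h, dif_neg, not_false_eq_true]; exact measurable_const
    have hFY (ω) : productChannel N Q k ω = F (Y ω) := by
      refine productChannel_congr fun j hj => ?_
      ext a b
      simp [entryMatrix, hj.trans hkK, S, hj, Y]
    have hY : AEMeasurable Y P :=
      aemeasurable_pi_lambda _ fun e => hQ.aemeasurable_entry e.1
    have hV := hQ.hasLaw_matrix hkK
    have hindep : IndepFun Y V P := by
      have h := hQ.indep.indepFun_finset₀ S T hST hQ.aemeasurable_entry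
      refine h.comp (φ := id) (ψ := fun (z : T → ℂ) (e : Fin (N (k + 1)) × Fin (N k)) =>
        z ⟨⟨⟨k, hkK⟩, e⟩, by simp [T]⟩) measurable_id ?_
      exact measurable_pi_lambda _ fun e => measurable_pi_apply _
    have hlaw : P.map (fun ω => (Y ω, V ω)) = (P.map Y).prod
        (gaussianVector (Fin (N (k + 1)) × Fin (N k))) := by
      rw [(indepFun_iff_map_prod_eq_prod_map_map hY hV.aemeasurable).1 hindep, hV.map_eq]
    have : IsProbabilityMeasure (P.map Y) := Measure.isProbabilityMeasure_map hY
    have hF : HasLogMean (P.map Y) (fun y => gramDet (F y)) _ :=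
      (hasLogMean_map_iff hY (measurable_gramDet hFm)).2
        (by simpa only [hFY] using ih hkK.le)
    have hprod := hF.gramDet_mul_gaussian (hN (k + 1) hk) hFm
    rw [← hlaw] at hprod
    have hD : Measurable fun z : (S → ℂ) × (Fin (N (k + 1)) × Fin (N k) → ℂ) =>
        gramDet (Matrix.of (Function.curry z.2) * F z.1) := by
      refine measurable_gramDet fun i j => ?_
      simp only [Matrix.mul_apply, Matrix.of_apply, Function.curry]
      refine Finset.measurable_sum _ fun l _ => Measurable.mul ?_ ?_
      · exact (measurable_pi_apply (i, l)).comp measurable_snd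
      · exact (hFm l j).comp measurable_fst
    have hfin := (hasLogMean_map_iff (hY.prodMk hV.aemeasurable) hD).1 hprod
    rw [Finset.sum_range_succ]
    convert! hfin using 1
    funext ω
    rw [productChannel, hFY]
    rfl

/-! ### Integrability of the capacity. -/

lemma integrable_norm_sq_stdComplexGaussian :
    Integrable (fun z : ℂ => ‖z‖ ^ 2) stdComplexGaussian := by
  refine ⟨by fun_prop, ?_⟩
  rw [hasFiniteIntegral_iff_ofReal (ae_of_all _ fun z => by positivity),
    lintegral_stdComplexGaussian_norm_sq (f := ENNReal.ofReal) (by fun_prop)]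
  have h := Real.GammaIntegral_convergent (s := 2) (by norm_num)
  have h2 := h.lintegral_lt_top
  refine lt_of_eq_of_lt (setLIntegral_congr_fun measurableSet_Ioi fun s hs => ?_) h2
  rw [← ENNReal.ofReal_mul (Real.exp_pos _).le]
  norm_num

/-- The squared Frobenius norm. -/
noncomputable def frobSq {m n : Type*} [Fintype m] [Fintype n] (A : Matrix m n ℂ) : ℝ :=
  ∑ i, ∑ j, ‖A i j‖ ^ 2

lemma frobSq_nonneg {m n : Type*} [Fintype m] [Fintype n] (A : Matrix m n ℂ) : 0 ≤ frobSq A :=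
  Finset.sum_nonneg fun _ _ => Finset.sum_nonneg fun _ _ => by positivity

lemma frobSq_mul_le {l m n : Type*} [Fintype l] [Fintype m] [Fintype n] (A : Matrix l m ℂ)
    (B : Matrix m n ℂ) : frobSq (A * B) ≤ frobSq A * frobSq B := by
  have hB : frobSq B = ∑ j, ∑ k, ‖B k j‖ ^ 2 := Finset.sum_comm
  rw [hB, frobSq, frobSq, Finset.sum_mul_sum]
  refine Finset.sum_le_sum fun i _ => Finset.sum_le_sum fun j _ => ?_
  calc ‖(A * B) i j‖ ^ 2 ≤ (∑ k, ‖A i k‖ * ‖B k j‖) ^ 2 := by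
        rw [Matrix.mul_apply]
        gcongr
        exact (norm_sum_le _ _).trans_eq (by simp)
    _ ≤ _ := Finset.sum_mul_sq_le_sq_mul_sq _ _ _

lemma IsRayleighChain.exists_aemeasurable_productChannel (hQ : IsRayleighChain P K N Q) {k : ℕ}
    (hk : k ≤ K) : ∃ Y : Ω → (ChannelEntry K N → ℂ), AEMeasurable Y P ∧
      ∀ ω, productChannel N Q k ω = productChannel N (entryMatrix K N) k (Y ω) := by
  refine ⟨fun ω e => Q (e.1 : ℕ) ω e.2.1 e.2.2,
    aemeasurable_pi_lambda _ hQ.aemeasurable_entry, fun ω => productChannel_congr fun j hj => ?_⟩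
  ext a b
  simp [entryMatrix, hj.trans_le hk]

/-- Submultiplicativity gives `1 + ‖AB‖² ≤ (1 + ‖A‖²)(1 + ‖B‖²)`, so logarithms add along the chain;
each new term is at most `‖Q k‖²`, which is integrable. -/
lemma IsRayleighChain.integrable_log_one_add_frobSq [IsProbabilityMeasure P]
    (hQ : IsRayleighChain P K N Q) {k : ℕ} (hk : k ≤ K) :
    Integrable (fun ω => Real.log (1 + frobSq (productChannel N Q k ω))) P := by
  induction k with
  | zero =>
    simp only [productChannel]
    exact integrable_const _
  | succ k ih =>
    have hQk : Integrable (fun ω => frobSq (Q k ω)) P := by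
      refine integrable_finsetSum _ fun i _ => integrable_finsetSum _ fun j _ => ?_
      have hl := hQ.law k hk i j
      have h := integrable_norm_sq_stdComplexGaussian
      rw [← hl.map_eq] at h
      exact h.comp_aemeasurable hl.aemeasurable
    refine Integrable.mono' (hQk.add (ih (Nat.le_of_succ_le hk))) ?_ (ae_of_all _ fun ω => ?_)
    · obtain ⟨Y, hY, hYH⟩ := hQ.exists_aemeasurable_productChannel hk
      simp only [hYH]
      refine (Measurable.comp_aemeasurable (g := fun q =>
        Real.log (1 + frobSq (productChannel N (entryMatrix K N) (k + 1) q)))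
        ?_ hY).aestronglyMeasurable
      have h (i j) := measurable_productChannel (measurable_entryMatrix K N) (k + 1) i j
      refine Real.measurable_log.comp (measurable_const.add ?_)
      exact Finset.measurable_sum _ fun i _ => Finset.measurable_sum _ fun j _ =>
        (h i j).norm.pow_const 2
    · have h1 := frobSq_nonneg (Q k ω)
      have h2 := frobSq_nonneg (productChannel N Q k ω)
      have h3 := frobSq_nonneg (productChannel N Q (k + 1) ω)
      have h4 := frobSq_mul_le (Q k ω) (productChannel N Q k ω)
      rw [Real.norm_of_nonneg (Real.log_nonneg (by linarith))]
      calc Real.log (1 + frobSq (productChannel N Q (k + 1) ω))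
          ≤ Real.log ((1 + frobSq (Q k ω)) * (1 + frobSq (productChannel N Q k ω))) := by
            refine Real.log_le_log (by linarith) ?_
            rw [productChannel]
            nlinarith
        _ = Real.log (1 + frobSq (Q k ω)) + Real.log (1 + frobSq (productChannel N Q k ω)) :=
            Real.log_mul (by positivity) (by positivity)
        _ ≤ _ := by
            refine add_le_add ?_ le_rfl
            have := Real.log_le_sub_one_of_pos (show 0 < 1 + frobSq (Q k ω) by linarith)
            linarith

end Chain

/-! ### Deterministic capacity bounds through singular values. -/

/-- The capacity, the Gram determinant and the Frobenius norm of `H` in terms of the squared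
singular values of `H`. -/
lemma exists_sq_singularValues {m n : ℕ} (H : Matrix (Fin m) (Fin n) ℂ) :
    ∃ d : Fin n → ℝ, (∀ i, 0 ≤ d i) ∧ gramDet H = ∏ i, d i ∧ frobSq H = ∑ i, d i ∧
      ∀ q : ℝ, 0 ≤ q → capacity H q = ∑ i, Real.log (1 + q * d i) := by
  have hpsd : (Hᴴ * H).IsHermitian := Matrix.isHermitian_conjTranspose_mul_self H
  have hnn (i) : 0 ≤ hpsd.eigenvalues i := Matrix.eigenvalues_conjTranspose_mul_self_nonneg H i
  refine ⟨hpsd.eigenvalues, hnn, ?_, ?_, fun q hq => ?_⟩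
  · rw [gramDet, hpsd.det_eq_prod_eigenvalues, ← RCLike.ofReal_prod]
    exact Complex.ofReal_re _
  · have h := hpsd.trace_eq_sum_eigenvalues
    have h2 : (Hᴴ * H).trace = ((frobSq H : ℝ) : ℂ) := by
      simp only [Matrix.trace, Matrix.diag, Matrix.mul_apply, Matrix.conjTranspose_apply, frobSq]
      rw [Finset.sum_comm]
      push_cast
      refine Finset.sum_congr rfl fun i _ => Finset.sum_congr rfl fun j _ => ?_
      exact_mod_cast (Complex.conj_mul' (H i j))
    rw [h2, ← RCLike.ofReal_sum] at h
    exact Complex.ofReal_injective h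
  · have hdet : (1 + (q : ℂ) • (Hᴴ * H)).det =
        ((∏ i, (1 + q * hpsd.eigenvalues i) : ℝ) : ℂ) := by
      have hs := hpsd.spectral_theorem
      rw [Unitary.conjStarAlgAut_apply] at hs
      set U := hpsd.eigenvectorUnitary
      have hU : (U : Matrix (Fin n) (Fin n) ℂ) * star (U : Matrix (Fin n) (Fin n) ℂ) = 1 :=
        Unitary.mul_star_self_of_mem U.2
      have h1 : 1 + (q : ℂ) • (Hᴴ * H) = (U : Matrix (Fin n) (Fin n) ℂ) *
          (1 + (q : ℂ) • Matrix.diagonal (RCLike.ofReal ∘ hpsd.eigenvalues)) *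
            star (U : Matrix (Fin n) (Fin n) ℂ) := by
        conv_lhs => rw [hs]
        rw [Matrix.mul_add, Matrix.add_mul, Matrix.mul_one, hU, Matrix.mul_smul,
          Matrix.smul_mul]
      rw [h1, Matrix.det_mul_right_comm, hU, Matrix.one_mul, ← Matrix.diagonal_one,
        ← Matrix.diagonal_smul, Matrix.diagonal_add, Matrix.det_diagonal]
      push_cast
      rfl
    rw [capacity, lnDet, hdet, Complex.ofReal_re, Real.log_prod]
    intro i _
    have := mul_nonneg hq (hnn i)
    positivity

lemma measurable_capacity {m n : ℕ} {α : Type*} [MeasurableSpace α]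
    {A : α → Matrix (Fin m) (Fin n) ℂ} (hA : ∀ i j, Measurable fun a => A a i j) (q : ℝ) :
    Measurable fun a => capacity (A a) q := by
  simp only [capacity, lnDet, Matrix.det_apply, Matrix.mul_apply, Matrix.conjTranspose_apply,
    Matrix.add_apply, Matrix.smul_apply]
  fun_prop

lemma capacity_nonneg {m n : ℕ} (H : Matrix (Fin m) (Fin n) ℂ) {q : ℝ} (hq : 0 ≤ q) :
    0 ≤ capacity H q := by
  obtain ⟨d, hd, -, -, hc⟩ := exists_sq_singularValues H
  rw [hc q hq]
  exact Finset.sum_nonneg fun i _ => Real.log_nonneg (by linarith [mul_nonneg hq (hd i)])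

/-- Every squared singular value is at most their sum `frobSq H`. This provides the integrable
majorant. -/
lemma capacity_le {m n : ℕ} (H : Matrix (Fin m) (Fin n) ℂ) {q : ℝ} (hq : 0 ≤ q) :
    capacity H q ≤ n * (Real.log (1 + q) + Real.log (1 + frobSq H)) := by
  obtain ⟨d, hd, -, hf, hc⟩ := exists_sq_singularValues H
  have hF := frobSq_nonneg H
  rw [hc q hq, ← Real.log_mul (by positivity) (by positivity)]
  calc ∑ i, Real.log (1 + q * d i) ≤ ∑ _i : Fin n, Real.log ((1 + q) * (1 + frobSq H)) := by
        refine Finset.sum_le_sum fun i _ => ?_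
        have hi : d i ≤ frobSq H := by
          rw [hf]
          exact Finset.single_le_sum (fun j _ => hd j) (Finset.mem_univ i)
        have := mul_nonneg hq (hd i)
        refine Real.log_le_log (by positivity) ?_
        nlinarith [mul_le_mul_of_nonneg_left hi hq]
    _ = _ := by simp

/-- The tangent line at `a` of the convex function `x ↦ log (1 + q * exp x)`, in the variable
`t = exp x`. -/
lemma log_one_add_mul_tangent {q t : ℝ} (hq : 0 < q) (ht : 0 < t) (a : ℝ) :
    Real.log (1 + q * Real.exp a) +
      q * Real.exp a / (1 + q * Real.exp a) * (Real.log t - a) ≤ Real.log (1 + q * t) := by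
  have hE := Real.exp_pos a
  set E := Real.exp a with hEdef
  have hpos : 0 < 1 + q * E := by positivity
  -- Concavity of `log` at the points `1` and `t / E`, with weights chosen so that their barycentre
  -- is `(1 + q * t) / (1 + q * E)`.
  have h := strictConcaveOn_log_Ioi.concaveOn.2 (Set.mem_Ioi.2 one_pos)
    (Set.mem_Ioi.2 (div_pos ht hE)) (show 0 ≤ 1 / (1 + q * E) by positivity)
    (show 0 ≤ q * E / (1 + q * E) by positivity) (by field_simp)
  simp only [smul_eq_mul, Real.log_one, mul_zero, zero_add, mul_one] at h
  rw [show 1 / (1 + q * E) + q * E / (1 + q * E) * (t / E) = (1 + q * t) / (1 + q * E) by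
      field_simp,
    Real.log_div ht.ne' hE.ne', Real.log_div (by positivity) hpos.ne', hEdef, Real.log_exp] at h
  linarith

section Pos

variable {m n : ℕ} {H : Matrix (Fin m) (Fin n) ℂ}

lemma exists_sq_singularValues_of_pos (hH : 0 < gramDet H) :
    ∃ d : Fin n → ℝ, (∀ i, 0 < d i) ∧ Real.log (gramDet H) = ∑ i, Real.log (d i) ∧
      ∀ q : ℝ, 0 ≤ q → capacity H q = ∑ i, Real.log (1 + q * d i) := by
  obtain ⟨d, hd, hg, -, hc⟩ := exists_sq_singularValues H
  have hd' (i) : d i ≠ 0 := by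
    rw [hg] at hH
    exact Finset.prod_ne_zero_iff.1 hH.ne' i (Finset.mem_univ i)
  exact ⟨d, fun i => (hd i).lt_of_ne' (hd' i), by rw [hg, Real.log_prod fun i _ => hd' i], hc⟩

lemma tangent_le_capacity (hH : 0 < gramDet H) {q : ℝ} (hq : 0 < q) (a : ℝ) :
    n * Real.log (1 + q * Real.exp a) +
      q * Real.exp a / (1 + q * Real.exp a) * (Real.log (gramDet H) - n * a) ≤ capacity H q := by
  obtain ⟨d, hd, hg, hc⟩ := exists_sq_singularValues_of_pos hH
  rw [hc q hq.le, hg]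
  refine le_trans (le_of_eq ?_)
    (Finset.sum_le_sum fun i _ => log_one_add_mul_tangent hq (hd i) a)
  rw [Finset.sum_add_distrib, ← Finset.mul_sum, Finset.sum_sub_distrib]
  simp

/-- Each of the `n` terms absorbs one `log q`. One family `d` serves all `q`, so different
signal-to-noise ratios can be compared termwise. -/
lemma capacity_sub_eq (hH : 0 < gramDet H) : ∃ d : Fin n → ℝ, (∀ i, 0 < d i) ∧
    Real.log (gramDet H) = ∑ i, Real.log (d i) ∧ capacity H 1 = ∑ i, Real.log (1 + d i) ∧
    ∀ q : ℝ, 0 < q → capacity H q - n * Real.log q = ∑ i, Real.log (q⁻¹ + d i) := by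
  obtain ⟨d, hd, hg, hc⟩ := exists_sq_singularValues_of_pos hH
  refine ⟨d, hd, hg, by simpa using hc 1 zero_le_one, fun q hq => ?_⟩
  have h (i) : Real.log (1 + q * d i) = Real.log q + Real.log (q⁻¹ + d i) := by
    have := hd i
    rw [← Real.log_mul hq.ne' (by positivity)]
    congr 1
    field_simp
  rw [hc q hq.le]
  simp [h, Finset.sum_add_distrib]

lemma tendsto_capacity_sub (hH : 0 < gramDet H) :
    Tendsto (fun q => capacity H q - n * Real.log q) atTop (𝓝 (Real.log (gramDet H))) := by
  obtain ⟨d, hd, hg, -, hc⟩ := capacity_sub_eq hH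
  have h : Tendsto (fun q : ℝ => ∑ i, Real.log (q⁻¹ + d i)) atTop (𝓝 (∑ i, Real.log (d i))) := by
    refine tendsto_finsetSum _ fun i _ => ?_
    have := (tendsto_inv_atTop_zero (𝕜 := ℝ)).add_const (d i)
    rw [zero_add] at this
    exact this.log (hd i).ne'
  rw [hg]
  refine h.congr' ?_
  filter_upwards [eventually_gt_atTop 0] with q hq using (hc q hq).symm

/-- For `q ≥ 1` each term satisfies `log d ≤ log (1/q + d) ≤ log (1 + d)`, giving a majorant free of
`q` for dominated convergence. -/
lemma abs_capacity_sub_le (hH : 0 < gramDet H) {q : ℝ} (hq : 1 ≤ q) :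
    |capacity H q - n * Real.log q| ≤ |Real.log (gramDet H)| + capacity H 1 := by
  obtain ⟨d, hd, hg, h1, hc⟩ := capacity_sub_eq hH
  have hq0 : 0 < q := one_pos.trans_le hq
  have hinv : q⁻¹ ≤ 1 := inv_le_one_of_one_le₀ hq
  have hlow : Real.log (gramDet H) ≤ capacity H q - n * Real.log q := by
    rw [hc q hq0, hg]
    refine Finset.sum_le_sum fun i _ => Real.log_le_log (hd i) ?_
    linarith [inv_pos.2 hq0]
  have hup : capacity H q - n * Real.log q ≤ capacity H 1 := by
    rw [hc q hq0, h1]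
    refine Finset.sum_le_sum fun i _ => Real.log_le_log ?_ (by linarith)
    have := hd i
    positivity
  have := capacity_nonneg H zero_le_one
  rw [abs_le]
  constructor
  · linarith [neg_abs_le (Real.log (gramDet H))]
  · linarith [abs_nonneg (Real.log (gramDet H))]

end Pos

/-! ### The constant `g` and the conclusion. -/

lemma harmonic_cast_eq (n : ℕ) : (harmonic n : ℝ) = ∑ r ∈ Finset.Icc 1 n, 1 / (r : ℝ) := by
  rw [harmonic_eq_sum_Icc]
  push_cast
  simp

lemma sum_harmonic_eq_gConst (K : ℕ) (N : ℕ → ℕ) (hN0 : 1 ≤ N 0) :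
    (∑ j ∈ Finset.range K, ∑ l ∈ Finset.range (N 0),
        ((harmonic (N (j + 1) - 1 - l) : ℝ) - Real.eulerMascheroniConstant)) =
      (N 0 : ℝ) * (gConst K N - (K : ℝ) * Real.eulerMascheroniConstant) := by
  have hN : (N 0 : ℝ) ≠ 0 := by positivity
  have hI (n : ℕ) (f : ℕ → ℝ) : ∑ i ∈ Finset.Icc 1 n, f i = ∑ i ∈ Finset.range n, f (i + 1) := by
    rw [Finset.range_eq_Ico, Finset.sum_Ico_add' f 0 n 1]
    rfl
  rw [gConst, mul_sub, ← mul_assoc, mul_one_div_cancel hN, one_mul, hI]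
  simp only [Finset.sum_sub_distrib, harmonic_cast_eq]
  congr 1
  · refine Finset.sum_congr rfl fun k _ => ?_
    rw [hI]
    refine Finset.sum_congr rfl fun l _ => ?_
    rw [show N (k + 1) - 1 - l = N (k + 1) - (l + 1) by omega]
  · simp
    ring

theorem corollary1 {Ω : Type*} [MeasurableSpace Ω] (P : Measure Ω) [IsProbabilityMeasure P]
    (K : ℕ) (hK : 1 ≤ K) (N : ℕ → ℕ) (hN0 : 1 ≤ N 0) (hN : ∀ k ≤ K, N 0 ≤ N k)
    (Q : (k : ℕ) → Ω → Matrix (Fin (N (k + 1))) (Fin (N k)) ℂ)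
    (hQ : IsRayleighChain P K N Q) :
    -- the expectations below are genuine: the integrands are defined a.s. and integrable
    (∀ q : ℝ, 0 < q → Integrable (fun ω => capacity (productChannel N Q K ω) q) P) ∧
    (∀ᵐ ω ∂P, 0 < ((productChannel N Q K ω)ᴴ * productChannel N Q K ω).det.re) ∧
    Integrable (fun ω => lnDet ((productChannel N Q K ω)ᴴ * productChannel N Q K ω)) P ∧
    -- the lower bound is a lower bound, and it is asymptotically tight
    (∀ q : ℝ, 0 < q →
      capacityLowerBound K N q ≤ ergodicCapacity P (productChannel N Q K) q) ∧
    Tendsto (fun q : ℝ => ergodicCapacity P (productChannel N Q K) q - capacityLowerBound K N q)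
      atTop (𝓝 0) ∧
    -- the high-SNR limit of the ergodic capacity and its value
    Tendsto (fun q : ℝ => ergodicCapacity P (productChannel N Q K) q - (N 0 : ℝ) * Real.log q)
      atTop (𝓝 (∫ ω, lnDet ((productChannel N Q K ω)ᴴ * productChannel N Q K ω) ∂P)) ∧
    (∫ ω, lnDet ((productChannel N Q K ω)ᴴ * productChannel N Q K ω) ∂P) =
      (N 0 : ℝ) * (gConst K N - (K : ℝ) * Real.eulerMascheroniConstant) := by

  have hL := hQ.hasLogMean_gramDet hN le_rfl
  rw [sum_harmonic_eq_gConst K N hN0] at hL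
  set a : ℝ := gConst K N - (K : ℝ) * Real.eulerMascheroniConstant with ha
  obtain ⟨Y, hY, hYH⟩ := hQ.exists_aemeasurable_productChannel le_rfl
  have hmeas (q : ℝ) : AEStronglyMeasurable (fun ω => capacity (productChannel N Q K ω) q) P := by
    simp only [hYH]
    exact ((measurable_capacity (fun i j => measurable_productChannel
      (measurable_entryMatrix K N) K i j) q).comp_aemeasurable hY).aestronglyMeasurable
  have hint (q : ℝ) (hq : 0 < q) :
      Integrable (fun ω => capacity (productChannel N Q K ω) q) P := by
    refine Integrable.mono' (((integrable_const (Real.log (1 + q))).add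
      (hQ.integrable_log_one_add_frobSq le_rfl)).const_mul (N 0 : ℝ)) (hmeas q)
      (ae_of_all _ fun ω => ?_)
    rw [Real.norm_of_nonneg (capacity_nonneg _ hq.le)]
    exact capacity_le _ hq.le
  have hlim : Tendsto (fun q : ℝ =>
      ergodicCapacity P (productChannel N Q K) q - (N 0 : ℝ) * Real.log q) atTop
      (𝓝 (∫ ω, lnDet ((productChannel N Q K ω)ᴴ * productChannel N Q K ω) ∂P)) := by
    have h : Tendsto (fun q : ℝ =>
        ∫ ω, (capacity (productChannel N Q K ω) q - (N 0 : ℝ) * Real.log q) ∂P) atTop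
        (𝓝 (∫ ω, Real.log (gramDet (productChannel N Q K ω)) ∂P)) := by
      refine tendsto_integral_filter_of_dominated_convergence
        (fun ω => |Real.log (gramDet (productChannel N Q K ω))| +
          capacity (productChannel N Q K ω) 1)
        (Eventually.of_forall fun q => (hmeas q).sub aestronglyMeasurable_const) ?_
        (hL.integrable.abs.add (hint 1 one_pos)) ?_
      · filter_upwards [eventually_ge_atTop 1] with q hq
        filter_upwards [hL.pos] with ω hω using abs_capacity_sub_le hω hq
      · filter_upwards [hL.pos] with ω hω using tendsto_capacity_sub hω
    refine h.congr' ?_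
    filter_upwards [eventually_gt_atTop 0] with q hq
    rw [integral_sub (hint q hq) (integrable_const _), integral_const]
    simp [ergodicCapacity]
  have hval : (∫ ω, lnDet ((productChannel N Q K ω)ᴴ * productChannel N Q K ω) ∂P) = N 0 * a :=
    hL.integral_eq
  refine ⟨hint, hL.pos, hL.integrable, fun q hq => ?_, ?_, hlim, hval⟩
  -- Since `N 0 * a` is exactly the mean of the log determinant, the linear part of the tangent
  -- integrates to zero.
  · have hlin : Integrable (fun ω => q * Real.exp a / (1 + q * Real.exp a) *
        (Real.log (gramDet (productChannel N Q K ω)) - N 0 * a)) P :=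
      (hL.integrable.sub (integrable_const _)).const_mul _
    have hmono := integral_mono_ae ((integrable_const
      ((N 0 : ℝ) * Real.log (1 + q * Real.exp a))).add hlin) (hint q hq)
      (by filter_upwards [hL.pos] with ω hω using tangent_le_capacity hω hq a)
    refine le_trans (le_of_eq ?_) hmono
    simp only [Pi.add_apply]
    rw [integral_add (integrable_const _) hlin, integral_const_mul (q * Real.exp a / (1 + q * Real.exp a)),
      integral_sub hL.integrable (integrable_const _), hL.integral_eq]
    simp [capacityLowerBound, ha]
  -- The lower bound minus `N 0 * log q` equals `N 0 * log (1/q + exp a)`, which has the limit `N 0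
  -- * a` already found for the capacity.
  · have h2 : Tendsto (fun q : ℝ => (N 0 : ℝ) * Real.log (q⁻¹ + Real.exp a)) atTop
        (𝓝 (N 0 * a)) := by
      have h := (tendsto_inv_atTop_zero (𝕜 := ℝ)).add_const (Real.exp a)
      rw [zero_add] at h
      have h' := (h.log (Real.exp_pos a).ne').const_mul (N 0 : ℝ)
      rwa [Real.log_exp] at h'
    rw [hval] at hlim
    have h3 := hlim.sub h2
    rw [sub_self] at h3
    refine h3.congr' ?_
    filter_upwards [eventually_gt_atTop 0] with q hq
    have hE := Real.exp_pos a
    have hfac : 1 + q * Real.exp a = q * (q⁻¹ + Real.exp a) := by field_simp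
    rw [capacityLowerBound, ← ha, hfac, Real.log_mul hq.ne' (by positivity)]
    ring
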